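/- For an integer $n\ge 1$, let $R_n$ be the hexagonal cylinder chain with $n$ hexagons, i.e. the multigraph with the $4n$ vertices $p_i,u_i,q_i,v_i$ and the $5n$ edges $p_iu_i,\ u_ip_{i+1},\ q_iv_i,\ v_iq_{i+1},\ p_iq_i$, where $i\in\mathbb{Z}/n\mathbb{Z}$ (for $n\ge 2$ it is a simple graph; for $n=1$ the two edges between $p_0$ and $u_0$ are parallel, and so are the two edges between $q_0$ and $v_0$). Regard every edge of a connected multigraph $G$ as a unit resistor, and let $r_G(a,b)$ be the effective resistance between the vertices $a$ and $b$, that is, the potential difference between $a$ and $b$ when a unit current enters at $a$ and leaves at $b$. The Kirchhoff index of $G$ is $K\!f(G)=\sum_{\{a,b\}\subseteq V_G} r_G(a,b)$, the sum over all unordered pairs of vertices. Then, with $\alpha=3-2\sqrt2$, $$K\!f(R_n)=\frac{4n^3-n}{3}+3\sqrt2\,n^2\,\frac{1+\alpha^n}{1-\alpha^n}.$$ -/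

import Mathlib

open scoped Graph

noncomputable section

namespace HexCylinder

/-! ### Resistance distance and Kirchhoff index of a finite multigraph -/

section Electrical

variable {α β : Type*} [Fintype α] [Fintype β]

open Classical in
/-- Every edge of `G` is a unit resistor. By Ohm's law a potential `φ` drives the current
`φ x - φ y` through an edge from `x` to `y`; this is the total current that leaves `x`. -/
def netCurrent (G : Graph α β) (φ : α → ℝ) (x : α) : ℝ :=
  ∑ e : β, ∑ y : α, if G.IsLink e x y then φ x - φ y else 0

open Classical in
/-- `φ` is the potential of a unit current that enters at `a` and leaves at `b`
(Kirchhoff's current law at every vertex). -/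
def IsUnitPotential (G : Graph α β) (a b : α) (φ : α → ℝ) : Prop :=
  ∀ x, netCurrent G φ x = (if x = a then 1 else 0) - (if x = b then 1 else 0)

open Classical in
/-- The resistance distance (effective resistance) between `a` and `b`: the potential difference
between `a` and `b` when a unit current enters at `a` and leaves at `b`. It does not depend on the
potential (`resistance_eq`), and a potential exists if `G` is connected
(`exists_isUnitPotential`); the value `0` in the other case is a convention. -/
def resistance (G : Graph α β) (a b : α) : ℝ :=
  if h : ∃ φ, IsUnitPotential G a b φ then h.choose a - h.choose b else 0

open Classical in
/-- The Kirchhoff index, the sum of the resistance distances over all unordered pairs of vertices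
(each unordered pair is counted twice in the double sum, and `resistance G a a = 0`). -/
def kirchhoffIndex (G : Graph α β) : ℝ :=
  (1 / 2) * ∑ a : α with a ∈ V(G), ∑ b : α with b ∈ V(G), resistance G a b

/-- The Laplacian is symmetric. -/
theorem sum_mul_netCurrent_comm (G : Graph α β) (φ ψ : α → ℝ) :
    ∑ x, ψ x * netCurrent G φ x = ∑ x, φ x * netCurrent G ψ x := by
  classical
  have key : ∀ φ ψ : α → ℝ, ∑ x, ψ x * netCurrent G φ x
      = ∑ e : β, ∑ x : α, ∑ y : α, if G.IsLink e x y then ψ x * φ x - ψ x * φ y else 0 := by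
    intro φ ψ
    rw [Finset.sum_comm]
    refine Finset.sum_congr rfl fun x _ => ?_
    simp only [netCurrent, Finset.mul_sum, mul_ite, mul_zero, mul_sub]
  rw [key, key, ← sub_eq_zero, ← Finset.sum_sub_distrib]
  refine Finset.sum_eq_zero fun e _ => ?_
  have h1 : ∀ φ ψ : α → ℝ,
      (∑ x : α, ∑ y : α, if G.IsLink e x y then ψ x * φ x - ψ x * φ y else 0)
      = (∑ x : α, ∑ y : α, if G.IsLink e x y then ψ x * φ x else 0)
        - ∑ x : α, ∑ y : α, if G.IsLink e x y then ψ x * φ y else 0 := by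
    intro φ ψ
    simp only [← Finset.sum_sub_distrib]
    refine Finset.sum_congr rfl fun x _ => Finset.sum_congr rfl fun y _ => ?_
    split_ifs <;> simp
  have h2 : (∑ x : α, ∑ y : α, if G.IsLink e x y then ψ x * φ y else 0)
      = ∑ x : α, ∑ y : α, if G.IsLink e x y then φ x * ψ y else 0 := by
    rw [Finset.sum_comm]
    refine Finset.sum_congr rfl fun x _ => Finset.sum_congr rfl fun y _ => ?_
    simp only [Graph.isLink_comm (x := x) (y := y), mul_comm (φ x) (ψ y)]
  rw [h1, h1, h2]
  simp only [mul_comm (φ _) (ψ _)]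
  ring

/-- The resistance distance can be read off from any unit potential. -/
theorem resistance_eq (G : Graph α β) (a b : α) (φ : α → ℝ) (hφ : IsUnitPotential G a b φ) :
    resistance G a b = φ a - φ b := by
  classical
  have h : ∃ φ, IsUnitPotential G a b φ := ⟨φ, hφ⟩
  have hs : ∀ φ ψ : α → ℝ, IsUnitPotential G a b φ →
      ∑ x, ψ x * netCurrent G φ x = ψ a - ψ b := by
    intro φ ψ hφ
    simp [hφ _, mul_sub, Finset.sum_sub_distrib]
  rw [resistance, dif_pos h, ← hs φ _ hφ, ← hs _ φ h.choose_spec]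
  exact sum_mul_netCurrent_comm G φ _

/-- In a multigraph in which only the constant functions are constant along all edges, every pair
of vertices has a unit potential. -/
theorem exists_isUnitPotential (G : Graph α β)
    (hG : ∀ φ : α → ℝ, (∀ e x y, G.IsLink e x y → φ x = φ y) → ∀ x y, φ x = φ y) (a b : α) :
    ∃ φ, IsUnitPotential G a b φ := by
  classical
  let L : (α → ℝ) →ₗ[ℝ] (α → ℝ) :=
    { toFun := netCurrent G
      map_add' := by
        intro φ ψ
        ext x
        simp only [netCurrent, Pi.add_apply, ← Finset.sum_add_distrib]
        refine Finset.sum_congr rfl fun e _ => Finset.sum_congr rfl fun y _ => ?_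
        split_ifs <;> ring
      map_smul' := by
        intro c φ
        ext x
        simp only [netCurrent, Pi.smul_apply, smul_eq_mul, Finset.mul_sum, RingHom.id_apply]
        refine Finset.sum_congr rfl fun e _ => Finset.sum_congr rfl fun y _ => ?_
        split_ifs <;> ring }
  let S : (α → ℝ) →ₗ[ℝ] ℝ := ∑ x, LinearMap.proj x
  have hS : ∀ φ, S φ = ∑ x, φ x := fun φ => by simp [S]
  have hle : LinearMap.range L ≤ LinearMap.ker S := by
    rintro _ ⟨φ, rfl⟩
    rw [LinearMap.mem_ker, hS]
    have := sum_mul_netCurrent_comm G φ (fun _ => 1)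
    simpa [netCurrent, L] using this
  have hker : LinearMap.ker L ≤ Submodule.span ℝ {fun _ => (1 : ℝ)} := by
    intro φ hφ
    have h0 : ∀ x, netCurrent G φ x = 0 := fun x => congrFun (LinearMap.mem_ker.1 hφ) x
    have hE : ∑ e : β, ∑ x : α, ∑ y : α, (if G.IsLink e x y then (φ x - φ y) ^ 2 else (0 : ℝ)) = 0 := by
      have h1 : ∑ x, φ x * netCurrent G φ x = 0 := by simp [h0]
      have h2 : ∑ e : β, ∑ x : α, ∑ y : α,
          (if G.IsLink e x y then φ x * (φ x - φ y) else 0) = 0 := by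
        refine Eq.trans ?_ h1
        rw [Finset.sum_comm]
        refine Finset.sum_congr rfl fun x _ => ?_
        simp only [netCurrent, Finset.mul_sum, mul_ite, mul_zero]
      have h3 : ∑ e : β, ∑ x : α, ∑ y : α,
          (if G.IsLink e x y then φ y * (φ y - φ x) else 0) = 0 := by
        refine Eq.trans ?_ h2
        refine Finset.sum_congr rfl fun e _ => ?_
        rw [Finset.sum_comm]
        refine Finset.sum_congr rfl fun x _ => Finset.sum_congr rfl fun y _ => ?_
        simp only [Graph.isLink_comm (x := x) (y := y)]
      refine Eq.trans ?_ ((congrArg₂ (· + ·) h2 h3).trans (add_zero 0))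
      simp only [← Finset.sum_add_distrib]
      refine Finset.sum_congr rfl fun e _ => Finset.sum_congr rfl fun x _ =>
        Finset.sum_congr rfl fun y _ => ?_
      split_ifs <;> ring
    have hc : ∀ e x y, G.IsLink e x y → φ x = φ y := by
      have hnn : ∀ e x y, 0 ≤ (if G.IsLink e x y then (φ x - φ y) ^ 2 else 0) := by
        intro e x y
        split_ifs <;> positivity
      intro e x y hl
      have h1 := (Finset.sum_eq_zero_iff_of_nonneg fun e _ => Finset.sum_nonneg fun x _ =>
        Finset.sum_nonneg fun y _ => hnn e x y).1 hE e (Finset.mem_univ _)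
      have h2 := (Finset.sum_eq_zero_iff_of_nonneg fun x _ =>
        Finset.sum_nonneg fun y _ => hnn e x y).1 h1 x (Finset.mem_univ _)
      have h3 := (Finset.sum_eq_zero_iff_of_nonneg fun y _ => hnn e x y).1 h2 y
        (Finset.mem_univ _)
      rw [if_pos hl] at h3
      exact sub_eq_zero.1 (pow_eq_zero_iff (two_ne_zero)|>.1 h3)
    refine Submodule.mem_span_singleton.2 ⟨φ a, ?_⟩
    ext x
    simpa using hG φ hc a x
  have hkd : Module.finrank ℝ (LinearMap.ker L) ≤ 1 :=
    (Submodule.finrank_mono hker).trans ((finrank_span_le_card _).trans (by simp))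
  have hL := LinearMap.finrank_range_add_finrank_ker L
  have hS' := LinearMap.finrank_range_add_finrank_ker S
  have hSr : LinearMap.range S = ⊤ := by
    refine LinearMap.range_eq_top.2 fun c => ⟨Pi.single a c, ?_⟩
    rw [hS]
    simp
  rw [hSr, finrank_top, Module.finrank_self] at hS'
  have heq : LinearMap.range L = LinearMap.ker S :=
    Submodule.eq_of_le_of_finrank_le hle (by omega)
  have hm : (fun x => (if x = a then 1 else 0) - (if x = b then 1 else 0) : α → ℝ)
      ∈ LinearMap.range L := by
    rw [heq, LinearMap.mem_ker, hS]
    simp [Finset.sum_sub_distrib]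
  obtain ⟨φ, hφ⟩ := hm
  exact ⟨φ, fun x => congrFun hφ x⟩

end Electrical

/-! ### The hexagonal cylinder chain -/

/-- The four families of vertices. -/
inductive VertexKind
  | p | u | q | v
  deriving DecidableEq

instance : Fintype VertexKind where
  elems := {.p, .u, .q, .v}
  complete x := by cases x <;> decide

/-- The five families of edges. -/
inductive EdgeKind
  | pu | up | qv | vq | pq
  deriving DecidableEq

instance : Fintype EdgeKind where
  elems := {.pu, .up, .qv, .vq, .pq}
  complete x := by cases x <;> decide

/-- `(p, i), (u, i), (q, i), (v, i)` are the vertices `p_i, u_i, q_i, v_i`, with indices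
modulo `n` (so that `p_0 = p_n` etc.). -/
abbrev Vertex (n : ℕ) : Type := VertexKind × ZMod n

/-- The edges are indexed by their family and the index of their first end. -/
abbrev Edge (n : ℕ) : Type := EdgeKind × ZMod n

/-- The ends of the edges. The two lateral edges of a hexagon are `p_i q_i` and
`p_{i+1} q_{i+1}`, its upper path is `p_i u_i p_{i+1}` and its lower path `q_i v_i q_{i+1}`. -/
def ends (n : ℕ) : Edge n → Sym2 (Vertex n)
  | (.pu, i) => s((.p, i), (.u, i))
  | (.up, i) => s((.u, i), (.p, i + 1))
  | (.qv, i) => s((.q, i), (.v, i))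
  | (.vq, i) => s((.v, i), (.q, i + 1))
  | (.pq, i) => s((.p, i), (.q, i))

/-- The hexagonal cylinder chain `R_n`, with `4 n` vertices and `5 n` edges: the cyclic chain of
the `n` hexagons `p_i u_i p_{i+1} q_{i+1} v_i q_i`, where consecutive hexagons share a lateral
edge. It has no parallel edges if `2 ≤ n`; for `n = 1`, the two edges between `p_0` and `u_0`
(and between `q_0` and `v_0`) are parallel. -/
def cylinder (n : ℕ) : Graph (Vertex n) (Edge n) where
  vertexSet := Set.univ
  IsLink e x y := ends n e = s(x, y)
  edgeSet := Set.univ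
  isLink_symm _ _ := ⟨fun _ _ h => h.trans Sym2.eq_swap⟩
  eq_or_eq_of_isLink_of_isLink := by
    intro e x y v w h h'
    rw [h, Sym2.eq_iff] at h'
    tauto
  edge_mem_iff_exists_isLink e := by
    refine ⟨fun _ => ?_, fun _ => Set.mem_univ _⟩
    induction h : ends n e with
    | _ x y => exact ⟨x, y, rfl⟩
  left_mem_of_isLink _ _ _ _ := Set.mem_univ _

/-- `R_n` is connected, so that all its resistance distances are genuine. -/
theorem exists_isUnitPotential_cylinder (n : ℕ) [NeZero n] (a b : Vertex n) :
    ∃ φ, IsUnitPotential (cylinder n) a b φ := by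
  refine exists_isUnitPotential _ (fun φ h => ?_) a b
  have h1 : ∀ i, φ (.p, i) = φ (.u, i) := fun i => h (.pu, i) _ _ rfl
  have h2 : ∀ i, φ (.u, i) = φ (.p, i + 1) := fun i => h (.up, i) _ _ rfl
  have h3 : ∀ i, φ (.q, i) = φ (.v, i) := fun i => h (.qv, i) _ _ rfl
  have h4 : ∀ i, φ (.p, i) = φ (.q, i) := fun i => h (.pq, i) _ _ rfl
  have h5 : ∀ k : ℕ, φ (.p, (k : ZMod n)) = φ (.p, 0) := by
    intro k
    induction k with
    | zero => simp
    | succ k ih => rw [← ih, h1 k, h2 k, Nat.cast_succ]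
  have h6 : ∀ i, φ (.p, i) = φ (.p, 0) := fun i => by
    rw [← ZMod.natCast_zmod_val i]; exact h5 _
  have h7 : ∀ x, φ x = φ (.p, 0) := by
    rintro ⟨_ | _ | _ | _, i⟩
    · exact h6 i
    · rw [← h1, h6]
    · rw [← h4, h6]
    · rw [← h3, ← h4, h6]
  intro x y
  rw [h7 x, h7 y]

end HexCylinder

end

/-!
The resistances of a multigraph can be read off from any family of potentials `g a` whose net
current is `δ_a - w` with the same background `w` for all sources `a`: the function `g a - g b` is
a unit potential, so that the Kirchhoff index is `N * ∑ a, g a a - ∑ a, ∑ b, g a b`, where `N` is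
the number of vertices (`kirchhoffIndex_eq_of_green`).

For the cylinder chain such a family is explicit. The involution `p ↔ q`, `u ↔ v` splits the
Laplacian into an even part, the Laplacian of the cycle `p₀ u₀ p₁ u₁ …` of length `2 n`, and an odd
part, the same operator with an additional `2` on the diagonal at the vertices `p_i`. In both parts
the vertices `u_i` can be eliminated, which leaves the equations
`2 s_i - s_{i-1} - s_{i+1} = 2 δ_{i0} - 2 / n` and `6 c_i - c_{i-1} - c_{i+1} = 2 δ_{i0}` on
`ℤ/nℤ`. They are solved by `s_d = d² / n - d` and by a multiple of `c_d = α ^ d + α ^ (n - d)`,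
since `α + α⁻¹ = 6`. The potentials of the cylinder are combinations of `s` and `c` (`green`), and
the sums over the vertices only need `∑ s`, `s 0` and `c 0`: the even part contributes
`(4 n³ - n) / 3`, the odd part `12 n² c 0` (`kirchhoffIndex_cylinder_eq`).
-/

namespace HexCylinder

/-! ### The Kirchhoff index from a family of potentials -/

section Green

variable {α β : Type*} [Fintype α] [Fintype β]

theorem netCurrent_sub (G : Graph α β) (φ ψ : α → ℝ) (x : α) :
    netCurrent G (fun y => φ y - ψ y) x = netCurrent G φ x - netCurrent G ψ x := by
  simp only [netCurrent, ← Finset.sum_sub_distrib]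
  refine Finset.sum_congr rfl fun e _ => Finset.sum_congr rfl fun y _ => ?_
  split_ifs <;> ring

open Classical in
/-- The background `w` is arbitrary because it cancels in `g a - g b`. -/
theorem resistance_eq_of_green (G : Graph α β) (g : α → α → ℝ) (w : α → ℝ)
    (hg : ∀ a x, netCurrent G (g a) x = (if x = a then 1 else 0) - w x) (a b : α) :
    resistance G a b = g a a - g a b + (g b b - g b a) := by
  rw [resistance_eq G a b (fun y => g a y - g b y)]
  · ring
  · intro x
    rw [netCurrent_sub, hg, hg]
    ring

open Classical in
theorem kirchhoffIndex_eq_of_green (G : Graph α β) (hV : V(G) = Set.univ) (g : α → α → ℝ)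
    (w : α → ℝ) (hg : ∀ a x, netCurrent G (g a) x = (if x = a then 1 else 0) - w x) :
    kirchhoffIndex G = Fintype.card α * ∑ a, g a a - ∑ a, ∑ b, g a b := by
  simp only [kirchhoffIndex, hV, Set.mem_univ, Finset.filter_true,
    resistance_eq_of_green G g w hg, Finset.sum_add_distrib, Finset.sum_sub_distrib,
    Finset.sum_const, Finset.card_univ, nsmul_eq_mul, ← Finset.mul_sum]
  rw [Finset.sum_comm (f := fun a b => g b a)]
  ring

end Green

/-! ### The Laplacian of the cylinder chain -/

section Laplacian

variable {n : ℕ} [NeZero n]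

/-- An edge with ends `a` and `b` contributes at `a` and at `b`; a loop would contribute `0`. -/
theorem sum_ite_mk_eq {α : Type*} [Fintype α] [DecidableEq α] (a b x : α) (φ : α → ℝ)
    [∀ y, Decidable (s(a, b) = s(x, y))] :
    ∑ y, (if s(a, b) = s(x, y) then φ x - φ y else 0)
      = (if a = x then φ a - φ b else 0) + (if b = x then φ b - φ a else 0) := by
  by_cases ha : a = x
  · subst ha
    have h : ∀ y, s(a, b) = s(a, y) ↔ b = y := fun y => Sym2.congr_right
    simp only [h, Finset.sum_ite_eq, Finset.mem_univ, if_true]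
    by_cases hb : b = a <;> simp [hb]
  · by_cases hb : b = x
    · subst hb
      have h : ∀ y, s(a, b) = s(b, y) ↔ a = y := fun y => by
        rw [Sym2.eq_swap, Sym2.congr_right]
      simp [h, ha]
    · rw [if_neg ha, if_neg hb, add_zero]
      refine Finset.sum_eq_zero fun y _ => if_neg ?_
      rw [Sym2.eq_iff]
      tauto

theorem sum_vertexKind (f : VertexKind → ℝ) : ∑ k, f k = f .p + f .u + f .q + f .v := by
  have : (Finset.univ : Finset VertexKind) = {.p, .u, .q, .v} := rfl
  rw [this]
  simp [add_assoc]

theorem sum_edgeKind (f : EdgeKind → ℝ) :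
    ∑ k, f k = f .pu + f .up + f .qv + f .vq + f .pq := by
  have : (Finset.univ : Finset EdgeKind) = {.pu, .up, .qv, .vq, .pq} := rfl
  rw [this]
  simp [add_assoc]

theorem netCurrent_cylinder (φ : Vertex n → ℝ) (x : Vertex n) :
    netCurrent (cylinder n) φ x = match x with
      | (.p, i) => 3 * φ (.p, i) - φ (.u, i) - φ (.u, i - 1) - φ (.q, i)
      | (.u, i) => 2 * φ (.u, i) - φ (.p, i) - φ (.p, i + 1)
      | (.q, i) => 3 * φ (.q, i) - φ (.v, i) - φ (.v, i - 1) - φ (.p, i)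
      | (.v, i) => 2 * φ (.v, i) - φ (.q, i) - φ (.q, i + 1) := by
  have h : ∀ e y, (cylinder n).IsLink e x y ↔ ends n e = s(x, y) := fun _ _ => Iff.rfl
  simp only [netCurrent, h, Fintype.sum_prod_type (α₁ := EdgeKind), sum_edgeKind, ends,
    sum_ite_mk_eq]
  obtain ⟨_ | _ | _ | _, i⟩ := x <;>
    simp [← eq_sub_iff_add_eq] <;> ring

end Laplacian

/-! ### Potentials of the cylinder chain from potentials on `ℤ/nℤ` -/

section Potentials

variable {n : ℕ} [NeZero n]

/-- Twice the even part of the potential with a given source (first argument), at a given vertex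
(second argument): a potential on the cycle `p₀ u₀ p₁ u₁ …` of length `2 n` of a unit current that
enters at the source and leaves evenly at all the vertices. The involution `p ↔ q`, `u ↔ v` may be
applied to either argument. -/
noncomputable def evenGreen (s : ZMod n → ℝ) : Vertex n → Vertex n → ℝ
  | (.p, j), (.p, i) | (.p, j), (.q, i) | (.q, j), (.p, i) | (.q, j), (.q, i) => s (i - j)
  | (.p, j), (.u, i) | (.p, j), (.v, i) | (.q, j), (.u, i) | (.q, j), (.v, i) =>
      (s (i - j) + s (i - j + 1)) / 2 - 1 / (4 * n)
  | (.u, j), (.p, i) | (.u, j), (.q, i) | (.v, j), (.p, i) | (.v, j), (.q, i) =>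
      (s (i - j) + s (i - j - 1)) / 2
  | (.u, j), (.u, i) | (.u, j), (.v, i) | (.v, j), (.u, i) | (.v, j), (.v, i) =>
      s (i - j) + 1 / (4 * n)

/-- The sign that the involution `p ↔ q`, `u ↔ v` flips. -/
noncomputable def VertexKind.sign : VertexKind → ℝ
  | .p | .u => 1
  | .q | .v => -1

/-- Twice the odd part of the potential, without its sign: the Green function of the Laplacian of
the cycle `p₀ u₀ p₁ u₁ …` with an additional `2` on the diagonal at the vertices `p_i`. -/
noncomputable def oddGreen (c : ZMod n → ℝ) : Vertex n → Vertex n → ℝ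
  | (.p, j), (.p, i) | (.p, j), (.q, i) | (.q, j), (.p, i) | (.q, j), (.q, i) => c (i - j)
  | (.p, j), (.u, i) | (.p, j), (.v, i) | (.q, j), (.u, i) | (.q, j), (.v, i) =>
      (c (i - j) + c (i - j + 1)) / 2
  | (.u, j), (.p, i) | (.u, j), (.q, i) | (.v, j), (.p, i) | (.v, j), (.q, i) =>
      (c (i - j) + c (i - j - 1)) / 2
  | (.u, j), (.u, i) | (.u, j), (.v, i) | (.v, j), (.u, i) | (.v, j), (.v, i) =>
      2 * c (i - j)

/-- A potential at `x` of a unit current that enters at `a` and leaves evenly at all the `4 n`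
vertices. -/
noncomputable def green (s c : ZMod n → ℝ) (a x : Vertex n) : ℝ :=
  (evenGreen s a x + a.1.sign * x.1.sign * oddGreen c a x) / 2

theorem netCurrent_green (s c : ZMod n → ℝ)
    (hs : ∀ i, 2 * s i - s (i - 1) - s (i + 1) = (if i = 0 then 2 else 0) - 2 / n)
    (hc : ∀ i, 6 * c i - c (i - 1) - c (i + 1) = if i = 0 then 2 else 0) (a x : Vertex n) :
    netCurrent (cylinder n) (green s c a) x = (if x = a then 1 else 0) - 1 / (4 * n) := by
  obtain ⟨k, j⟩ := a
  obtain ⟨l, i⟩ := x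
  have e1 : i - 1 - j = i - j - 1 := by ring
  have e2 : i + 1 - j = i - j + 1 := by ring
  have e3 : i = j ↔ i - j = 0 := sub_eq_zero.symm
  have hn : (2 : ℝ) / n = 8 * (1 / (4 * n)) := by
    have : (n : ℝ) ≠ 0 := NeZero.ne _
    field_simp
    norm_num
  have hs0 := hs (i - j)
  have hs1 := hs (i - j - 1)
  have hc0 := hc (i - j)
  have hc1 := hc (i - j - 1)
  rw [hn] at hs0 hs1
  rw [netCurrent_cylinder]
  rcases k <;> rcases l <;>
    simp only [green, evenGreen, oddGreen, VertexKind.sign, e1, e2, e3, Prod.mk.injEq,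
      reduceCtorEq, false_and, true_and, if_false, sub_add_cancel, add_sub_cancel_right]
      at hs0 hs1 hc0 hc1 ⊢ <;>
    generalize (1 : ℝ) / (4 * n) = t at * <;>
    split_ifs at * <;> linarith

theorem sum_sub_right (f : ZMod n → ℝ) (j : ZMod n) : ∑ i, f (i - j) = ∑ i, f i :=
  Equiv.sum_comp (Equiv.subRight j) f

theorem sum_sub_add_one (f : ZMod n → ℝ) (j : ZMod n) : ∑ i, f (i - j + 1) = ∑ i, f i :=
  (sum_sub_right (fun i => f (i + 1)) j).trans (Equiv.sum_comp (Equiv.addRight 1) f)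

theorem sum_sub_sub_one (f : ZMod n → ℝ) (j : ZMod n) : ∑ i, f (i - j - 1) = ∑ i, f i :=
  (sum_sub_right (fun i => f (i - 1)) j).trans (sum_sub_right f 1)

theorem kirchhoffIndex_cylinder_eq (s c : ZMod n → ℝ)
    (hs : ∀ i, 2 * s i - s (i - 1) - s (i + 1) = (if i = 0 then 2 else 0) - 2 / n)
    (hc : ∀ i, 6 * c i - c (i - 1) - c (i + 1) = if i = 0 then 2 else 0) :
    kirchhoffIndex (cylinder n)
      = 8 * (n : ℝ) ^ 2 * s 0 + n - 8 * n * ∑ i, s i + 12 * (n : ℝ) ^ 2 * c 0 := by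
  have hn : (n : ℝ) ≠ 0 := NeZero.ne _
  have hcard : Fintype.card (Vertex n) = 4 * n := by
    rw [Fintype.card_prod, ZMod.card]
    rfl
  have htr : ∑ a : Vertex n, green s c a a = 2 * n * s 0 + 1 / 4 + 3 * n * c 0 := by
    rw [Fintype.sum_prod_type, sum_vertexKind]
    simp only [green, evenGreen, oddGreen, VertexKind.sign, sub_self, Finset.sum_const,
      Finset.card_univ, ZMod.card, nsmul_eq_mul]
    field_simp
    ring
  have htot : ∑ a : Vertex n, ∑ b, green s c a b = 8 * n * ∑ i, s i := by
    simp only [Fintype.sum_prod_type (α₁ := VertexKind), sum_vertexKind, green, evenGreen,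
      oddGreen, VertexKind.sign, ← Finset.sum_div, Finset.sum_add_distrib,
      Finset.sum_sub_distrib, ← Finset.mul_sum, sum_sub_right, sum_sub_add_one, sum_sub_sub_one,
      Finset.sum_const, Finset.card_univ, ZMod.card, nsmul_eq_mul]
    ring
  rw [kirchhoffIndex_eq_of_green (cylinder n) rfl (green s c) (fun _ => 1 / (4 * n))
    fun a x => ?_, hcard, htr, htot]
  · push_cast
    ring
  · rw [netCurrent_green s c hs hc]
    congr

end Potentials

/-! ### The two potentials on `ℤ/nℤ` -/

section Cycle

variable {n : ℕ} [NeZero n]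

/-- Second differences on `ℤ/nℤ` of a function given on `0, …, n - 1` by a function `F` on `ℤ` with
`F n = F 0`: only at `0` they differ from those of `F`. -/
theorem val_add_one_and_sub_one (F : ℤ → ℝ) (hF : F n = F 0) (i : ZMod n) :
    F (i + 1).val = F (i.val + 1) ∧
      F (i - 1).val = F (i.val - 1) + if i = 0 then F (n - 1) - F (-1) else 0 := by
  have hn : 0 < n := NeZero.pos n
  have hlt := ZMod.val_lt i
  have hi : ((i.val : ℕ) : ZMod n) = i := ZMod.natCast_zmod_val i
  constructor
  · have h : (i + 1).val = (i.val + 1) % n := by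
      rw [← ZMod.val_natCast, Nat.cast_add, hi, Nat.cast_one]
    rw [h]
    rcases Nat.lt_or_ge (i.val + 1) n with h1 | h1
    · rw [Nat.mod_eq_of_lt h1]
      push_cast
      rfl
    · have h2 : i.val + 1 = n := by omega
      have h3 : (i.val : ℤ) + 1 = n := by exact_mod_cast h2
      rw [h2, h3, Nat.mod_self, hF, Nat.cast_zero]
  · by_cases h0 : i = 0
    · have h : (i - 1).val = n - 1 := by
        have : i - 1 = ((n - 1 : ℕ) : ZMod n) := by
          rw [Nat.cast_sub hn, h0]
          simp
        rw [this, ZMod.val_cast_of_lt (by omega)]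
      rw [h, if_pos h0, h0, ZMod.val_zero, Nat.cast_sub hn]
      simp
    · have hpos : 1 ≤ i.val := Nat.one_le_iff_ne_zero.2 fun h => h0 ((ZMod.val_eq_zero i).1 h)
      have h : (i - 1).val = i.val - 1 := by
        have : i - 1 = ((i.val - 1 : ℕ) : ZMod n) := by
          rw [Nat.cast_sub hpos, hi, Nat.cast_one]
        rw [this, ZMod.val_cast_of_lt (by omega)]
      rw [h, if_neg h0, Nat.cast_sub hpos]
      simp

theorem exists_even_potential : ∃ s : ZMod n → ℝ,
    (∀ i, 2 * s i - s (i - 1) - s (i + 1) = (if i = 0 then 2 else 0) - 2 / n) ∧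
      s 0 = 0 ∧ ∑ i, s i = (1 - (n : ℝ) ^ 2) / 6 := by
  have hn : (n : ℝ) ≠ 0 := NeZero.ne _
  let F : ℤ → ℝ := fun d => (d : ℝ) ^ 2 / n - d
  have hF : F n = F 0 := by
    simp only [F]
    push_cast
    field_simp
    ring
  refine ⟨fun i => F i.val, fun i => ?_, by simp [F], ?_⟩
  · obtain ⟨h1, h2⟩ := val_add_one_and_sub_one F hF i
    beta_reduce
    rw [h1, h2]
    simp only [F]
    push_cast
    split_ifs <;> field_simp <;> ring
  · have h : ∀ m : ℕ, ∑ d ∈ Finset.range m, F d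
        = (m - 1) * m * (2 * m - 1) / 6 / n - (m - 1) * m / 2 := by
      intro m
      induction m with
      | zero => simp
      | succ m ih =>
        rw [Finset.sum_range_succ, ih]
        simp only [F]
        push_cast
        ring
    have hsum : ∑ i : ZMod n, F i.val = ∑ d ∈ Finset.range n, F d := by
      refine Finset.sum_bij (fun i _ => i.val) (fun i _ => Finset.mem_range.2 (ZMod.val_lt i))
        (fun i _ j _ hij => ZMod.val_injective n hij) (fun d hd => ?_) fun _ _ => rfl
      exact ⟨d, Finset.mem_univ _, ZMod.val_cast_of_lt (Finset.mem_range.1 hd)⟩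
    rw [hsum, h]
    field_simp
    ring

theorem exists_odd_potential (α : ℝ) (hα : α = 3 - 2 * Real.sqrt 2) : ∃ c : ZMod n → ℝ,
    (∀ i, 6 * c i - c (i - 1) - c (i + 1) = if i = 0 then 2 else 0) ∧
      c 0 = Real.sqrt 2 / 4 * ((1 + α ^ n) / (1 - α ^ n)) := by
  have hr : Real.sqrt 2 ^ 2 = 2 := Real.sq_sqrt (by norm_num)
  have hr0 : 0 ≤ Real.sqrt 2 := Real.sqrt_nonneg 2
  have hα0 : 0 < α := by nlinarith
  have hα1 : α < 1 := by nlinarith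
  have hα' : α ≠ 0 := hα0.ne'
  have hinv : α⁻¹ = 3 + 2 * Real.sqrt 2 := by
    refine inv_eq_of_mul_eq_one_right ?_
    rw [hα]
    linear_combination -4 * hr
  have hD : 1 - α ^ n ≠ 0 := (sub_pos.2 (pow_lt_one₀ hα0.le hα1 (NeZero.ne n))).ne'
  let F : ℤ → ℝ := fun d => Real.sqrt 2 / 4 / (1 - α ^ n) * (α ^ d + α ^ (n - d))
  have hF : F n = F 0 := by
    simp only [F, sub_self, sub_zero]
    ring
  refine ⟨fun i => F i.val, fun i => ?_, ?_⟩
  · obtain ⟨h1, h2⟩ := val_add_one_and_sub_one F hF i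
    -- `F` satisfies the recurrence on `ℤ`, because `α + α⁻¹ = 6`.
    have hrec : ∀ d, 6 * F d - F (d - 1) - F (d + 1) = 0 := by
      intro d
      have e1 : (n : ℤ) - (d - 1) = n - d + 1 := by ring
      have e2 : (n : ℤ) - (d + 1) = n - d - 1 := by ring
      simp only [F, e1, e2, zpow_add_one₀ hα', zpow_sub_one₀ hα', hinv]
      rw [hα]
      ring
    have hjump : F (n - 1) - F (-1) = -2 := by
      have e1 : (n : ℤ) - (n - 1) = 1 := by ring
      have e2 : (n : ℤ) - -1 = n + 1 := by ring
      simp only [F, e1, e2, zpow_add_one₀ hα', zpow_sub_one₀ hα', zpow_one, zpow_neg,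
        zpow_natCast, hinv]
      field_simp
      rw [hα]
      linear_combination -4 * (1 - (3 - 2 * Real.sqrt 2) ^ n) * hr
    beta_reduce
    rw [h1, h2, hjump]
    have := hrec i.val
    split_ifs <;> linarith
  · simp only [F, ZMod.val_zero, Nat.cast_zero, zpow_zero, sub_zero, zpow_natCast]
    ring

end Cycle

end HexCylinder

theorem theorem5p2 (n : ℕ) [NeZero n] (α : ℝ) (hα : α = 3 - 2 * Real.sqrt 2) :
    HexCylinder.kirchhoffIndex (HexCylinder.cylinder n)
      = (4 * (n : ℝ) ^ 3 - (n : ℝ)) / 3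
        + 3 * Real.sqrt 2 * (n : ℝ) ^ 2 * ((1 + α ^ n) / (1 - α ^ n)) := by
  obtain ⟨s, hs, hs0, hsum⟩ := HexCylinder.exists_even_potential (n := n)
  obtain ⟨c, hc, hc0⟩ := HexCylinder.exists_odd_potential (n := n) α hα
  rw [HexCylinder.kirchhoffIndex_cylinder_eq s c hs hc, hs0, hsum, hc0]
  ring
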